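/- Let $k\in\mathbb{N}$, let $N=\mathbb{C}^k$ with coordinates $\sigma=(\sigma_1,\dots,\sigma_k)$, let $D_N$ be the sheaf of holomorphic differential operators on $N$, and write $\partial_h=\partial/\partial\sigma_h$, $E=\sum_{h=1}^k\sigma_h\partial_h$ and $P_\sigma(a)=a^k+\sum_{h=1}^k(-1)^h\sigma_h a^{k-h}$. Let $\mu\in\mathbb{C}\setminus\{0,-1,-2,\dots\}$, and let $\mathcal{I}_\mu\subset D_N$ be the left ideal generated by the operators $$A_{p,q}=\partial_p\partial_q-\partial_{p+1}\partial_{q-1}\quad(1\le p\le k-1,\ 2\le q\le k),\qquad T^m_\mu=\partial_1\partial_{m-1}+\partial_m(E+\mu)\quad(2\le m\le k).$$ For $q\in\mathbb{N}$ define the polynomial $$\Phi_{\mu,q}(\sigma)=(-1)^q\sum_{p=0}^{q}\binom{-\mu}{p}\,\tilde m_{p,q}(\sigma),\qquad \tilde m_{p,q}(\sigma)=p!\sum_{\substack{\alpha\in\mathbb{N}^k,\ \sum_h\alpha_h=p\\ \sum_h h\alpha_h=q}}\frac{\sigma^\alpha}{\alpha!},$$ that is, the part of weight $q$ (where $\sigma_h$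 has weight $h$) of the Taylor expansion at $\sigma=0$ of $\big(1+\sum_{h=1}^k(-1)^h\sigma_h\big)^{-\mu}$. Then for every $x\in N$: 1. There is $R_0$ such that, for every $R\ge R_0$, the stalk $\mathcal{I}_{\mu,x}$ is the set of all germs $\Pi\in D_{N,x}$ that annihilate, for each $a\in\mathbb{C}$ with $|a|>R$, the germ at $x$ of the function $\sigma\mapsto\big(a^k/P_\sigma(a)\big)^\mu=\exp\big(\mu\,\mathrm{Log}(a^k/P_\sigma(a))\big)$, which is holomorphic near $x$ (with $\mathrm{Log}$ the principal determination). 2. $\mathcal{I}_{\mu,x}$ is the set of all germs $\Pi\in D_{N,x}$ that annihilate the polynomial $\Phi_{\mu,q}$ for every $q\in\mathbb{N}$. -/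

import Mathlib

open Filter Topology

noncomputable section

namespace TraceSystem

/-- The functions on `ℂ^k` that are analytic at `x`. The coordinate `σ_h` (`1 ≤ h ≤ k`) is the one
with index `h - 1 : Fin k`. -/
def analyticFun (k : ℕ) (x : Fin k → ℂ) : Subalgebra ℂ ((Fin k → ℂ) → ℂ) where
  carrier := {f | AnalyticAt ℂ f x}
  mul_mem' hf hg := AnalyticAt.mul hf hg
  add_mem' hf hg := AnalyticAt.add hf hg
  algebraMap_mem' _ := analyticAt_const

/-- The functions that vanish in a neighbourhood of `x`. -/
def zeroGerm (k : ℕ) (x : Fin k → ℂ) : Ideal (analyticFun k x) where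
  carrier := {f | ∀ᶠ y in 𝓝 x, (f : (Fin k → ℂ) → ℂ) y = 0}
  zero_mem' := Eventually.of_forall fun _ => rfl
  add_mem' {f g} hf hg := by
    filter_upwards [hf, hg] with y h1 h2
    simp [h1, h2]
  smul_mem' c f hf := by
    filter_upwards [hf] with y h1
    simp [h1]

/-- The stalk at `x` of the sheaf of holomorphic functions on `ℂ^k`: functions analytic at `x`,
up to equality in a neighbourhood of `x`. -/
abbrev HolGerm (k : ℕ) (x : Fin k → ℂ) : Type := analyticFun k x ⧸ zeroGerm k x

/-- The germ at `x` of a function analytic at `x`. -/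
def germAt {k : ℕ} {x : Fin k → ℂ} (f : (Fin k → ℂ) → ℂ) (hf : AnalyticAt ℂ f x) : HolGerm k x :=
  Ideal.Quotient.mk (zeroGerm k x) ⟨f, hf⟩

/-- The partial derivative with respect to the coordinate of index `i`, on functions analytic at
`x`. -/
def partialFun {k : ℕ} {x : Fin k → ℂ} (i : Fin k) (f : analyticFun k x) : analyticFun k x :=
  ⟨fun y => fderiv ℂ (f : (Fin k → ℂ) → ℂ) y (Pi.single i 1),
    ((ContinuousLinearMap.apply ℂ ℂ (Pi.single i 1 : Fin k → ℂ)).analyticAt _).comp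
      (AnalyticAt.fderiv f.2)⟩

theorem partialFun_congr {k : ℕ} {x : Fin k → ℂ} (i : Fin k) (f g : analyticFun k x)
    (h : (f : (Fin k → ℂ) → ℂ) =ᶠ[𝓝 x] g) :
    (partialFun i f : (Fin k → ℂ) → ℂ) =ᶠ[𝓝 x] partialFun i g := by
  filter_upwards [h.fderiv (𝕜 := ℂ)] with y hy
  simp only [partialFun, hy]

theorem mk_eq_of_eventuallyEq {k : ℕ} {x : Fin k → ℂ} {f g : analyticFun k x}
    (h : (f : (Fin k → ℂ) → ℂ) =ᶠ[𝓝 x] g) :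
    Ideal.Quotient.mk (zeroGerm k x) f = Ideal.Quotient.mk (zeroGerm k x) g := by
  refine Ideal.Quotient.eq.2 ?_
  filter_upwards [h] with y hy
  simp [hy]

theorem eventuallyEq_of_mk_eq {k : ℕ} {x : Fin k → ℂ} {f g : analyticFun k x}
    (h : Ideal.Quotient.mk (zeroGerm k x) f = Ideal.Quotient.mk (zeroGerm k x) g) :
    (f : (Fin k → ℂ) → ℂ) =ᶠ[𝓝 x] g := by
  have h' : ∀ᶠ y in 𝓝 x, ((f - g : analyticFun k x) : (Fin k → ℂ) → ℂ) y = 0 :=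
    Ideal.Quotient.eq.1 h
  filter_upwards [h'] with y hy
  simpa [sub_eq_zero] using hy

/-- The partial derivative with respect to the coordinate of index `i`,
acting on germs of holomorphic functions. -/
def partialOp {k : ℕ} {x : Fin k → ℂ} (i : Fin k) : Module.End ℂ (HolGerm k x) where
  toFun := Quotient.lift (fun f => Ideal.Quotient.mk (zeroGerm k x) (partialFun i f))
    fun f g h => mk_eq_of_eventuallyEq
      (partialFun_congr i f g (eventuallyEq_of_mk_eq (Quotient.sound h)))
  map_add' u v := by
    obtain ⟨f, rfl⟩ := Ideal.Quotient.mk_surjective u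
    obtain ⟨g, rfl⟩ := Ideal.Quotient.mk_surjective v
    refine mk_eq_of_eventuallyEq (f := partialFun i (f + g))
      (g := partialFun i f + partialFun i g) ?_
    filter_upwards [AnalyticAt.eventually_analyticAt f.2,
      AnalyticAt.eventually_analyticAt g.2] with y h1 h2
    simp [partialFun, fderiv_add h1.differentiableAt h2.differentiableAt]
  map_smul' r u := by
    obtain ⟨f, rfl⟩ := Ideal.Quotient.mk_surjective u
    refine mk_eq_of_eventuallyEq (f := partialFun i (r • f)) (g := r • partialFun i f) ?_
    filter_upwards [AnalyticAt.eventually_analyticAt f.2] with y h1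
    simp [partialFun, fderiv_const_smul h1.differentiableAt]

/-- The stalk at `x` of the sheaf `D_N` of holomorphic differential operators on `N = ℂ^k`: the
algebra of operators on germs of holomorphic functions that is generated by the multiplications by
germs of holomorphic functions and by the partial derivatives. -/
def DiffOp (k : ℕ) (x : Fin k → ℂ) : Subalgebra ℂ (Module.End ℂ (HolGerm k x)) :=
  Algebra.adjoin ℂ (Set.range (LinearMap.mulLeft ℂ) ∪ Set.range partialOp)

/-- The partial derivative as an element of the ring of differential operators. -/
def pd {k : ℕ} (x : Fin k → ℂ) (i : Fin k) : DiffOp k x :=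
  ⟨partialOp i, Algebra.subset_adjoin (Or.inr ⟨i, rfl⟩)⟩

/-- The coordinate function of index `i`, as a differential operator of order `0`. -/
def coord {k : ℕ} (x : Fin k → ℂ) (i : Fin k) : DiffOp k x :=
  ⟨LinearMap.mulLeft ℂ (germAt (fun σ => σ i) 
    ((ContinuousLinearMap.proj (R := ℂ) (φ := fun _ : Fin k => ℂ) i).analyticAt x)),
    Algebra.subset_adjoin (Or.inl ⟨_, rfl⟩)⟩

/-- The Euler field `E = ∑ σ_h ∂_h`. -/
def euler {k : ℕ} (x : Fin k → ℂ) : DiffOp k x :=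
  ∑ h : Fin k, coord x h * pd x h

/-- The germs at `x` of the operators `A_{p,q} = ∂_p ∂_q - ∂_{p+1} ∂_{q-1}` for `p ∈ [1, k-1]` and
`q ∈ [2, k]`; here `p'` stands for `p + 1` and `q'` for `q - 1`. -/
def opsA {k : ℕ} (x : Fin k → ℂ) : Set (DiffOp k x) :=
  {Q | ∃ p p' q q' : Fin k, (p' : ℕ) = p + 1 ∧ (q : ℕ) = q' + 1 ∧
    Q = pd x p * pd x q - pd x p' * pd x q'}

/-- The germs at `x` of the operators `T^m_μ = ∂_1 ∂_{m-1} + ∂_m (E + μ)` for `m ∈ [2, k]`;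
here `o` stands for the index `1` and `m'` for `m - 1`. -/
def opsT {k : ℕ} (μ : ℂ) (x : Fin k → ℂ) : Set (DiffOp k x) :=
  {Q | ∃ o m m' : Fin k, (o : ℕ) = 0 ∧ (m : ℕ) = m' + 1 ∧
    Q = pd x o * pd x m' + pd x m * (euler x + algebraMap ℂ (DiffOp k x) μ)}

/-- The stalk at `x` of the left ideal `I_μ` of `D_N` (an `Ideal` of a noncommutative ring is a
left ideal). -/
def idealI {k : ℕ} (μ : ℂ) (x : Fin k → ℂ) : Ideal (DiffOp k x) :=
  Ideal.span (opsA x ∪ opsT μ x)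

/-- `P_σ(a) = a^k + ∑_{h=1}^k (-1)^h σ_h a^{k-h}`. -/
def univPoly {k : ℕ} (σ : Fin k → ℂ) (a : ℂ) : ℂ :=
  a ^ k + ∑ h : Fin k, (-1) ^ ((h : ℕ) + 1) * σ h * a ^ (k - ((h : ℕ) + 1))

/-- The function `σ ↦ (a^k / P_σ(a))^μ = exp (μ Log (a^k / P_σ(a)))`. For `|a|` large compared with
`σ` the quotient is close to `1`, and `Log` is the principal determination. -/
def powFun {k : ℕ} (μ a : ℂ) (σ : Fin k → ℂ) : ℂ :=
  (a ^ k / univPoly σ a) ^ μ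

/-- The polynomial `m̃_{p,q} = p! ∑_{|α| = p, w(α) = q} σ^α / α!`, where `w(α) = ∑ h α_h`. -/
def mTilde (k p q : ℕ) : MvPolynomial (Fin k) ℂ :=
  ∑ α ∈ (Finset.univ : Finset (Fin k)).finsuppAntidiag p with
      ∑ h : Fin k, ((h : ℕ) + 1) * α h = q,
    MvPolynomial.monomial α ((p.factorial : ℂ) / ∏ h : Fin k, ((α h).factorial : ℂ))

/-- The polynomial `Φ_{μ,q} = (-1)^q ∑_p Γ_{μ,p} m̃_{p,q}`, where `(1 + z)^{-μ} = ∑_p Γ_{μ,p} z^p`,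
that is, `Γ_{μ,p}` is the binomial coefficient of `-μ` over `p`. The terms with `p > q` vanish. -/
def Phi (k : ℕ) (μ : ℂ) (q : ℕ) : MvPolynomial (Fin k) ℂ :=
  (-1) ^ q * ∑ p ∈ Finset.range (q + 1), Ring.choose (-μ) p • mTilde k p q

/-- `f` is holomorphic near `x` and the germ `Q` of differential operator annihilates its germ. -/
def Kills {k : ℕ} {x : Fin k → ℂ} (Q : DiffOp k x) (f : (Fin k → ℂ) → ℂ) : Prop :=
  ∃ hf : AnalyticAt ℂ f x, (Q : Module.End ℂ (HolGerm k x)) (germAt f hf) = 0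

end TraceSystem

end

noncomputable section

namespace TraceSystem

/-! ### Rings of differential operators, algebraically -/

/-! Put z = 1/a and u = 1 + ∑ (-1)^h σ_h z^h, so that the functions of the first statement are
u^(-μ), and the Φ_{μ,q} are the coefficients of the formal series u^(-μ) in z. Each ∂_h multiplies
by a scalar times z^h and lowers the exponent by one. Hence a monomial in the ∂_h acts on u^(-μ)
through its order and weight alone, and E u = u - 1 gives (E + μ) u^(-μ) = μ u^(-μ-1). This is why
the generators annihilate u^(-μ).

For the converse, the A_{p,q} identify modulo the ideal all monomials of equal order and weight
(`mon_sub_mon_mem`). The T^m rewrite a monomial of order n containing some ∂_m with m ≥ 2 by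
monomials of order n + 1, after division by μ + n, which the assumption on μ permits. So every
operator is congruent to a combination of powers ∂_1^p with p < d and of monomials of order d
(`exists_mem_reducible`). Such a normal form sends u^(-μ) to G(z) u^(-μ-d), with G a polynomial over
the functions of σ. The constant term of u being 1, G determines the normal form by a triangular
system (`normalForm_eq_zero`).

If an operator annihilates u^(-μ), for infinitely many scalars z or formally in z, then G = 0
because u^(-μ-d) is invertible, and the operator lies in the ideal (`exists_symbol`). `Frame` and
`PowerFamily` isolate what the analytic and formal cases share. -/

/-- A ring `D` generated by a commutative ring `A` and commuting elements `pd i` that act on `A` by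
derivations `der i`, with coordinates `cg j ∈ A` dual to the derivations. -/
structure Frame (k : ℕ) (A D : Type*) [CommRing A] [Algebra ℂ A] [Ring D] [Algebra ℂ D] where
  mulHom : A →ₐ[ℂ] D
  pd : Fin k → D
  der : Fin k → A → A
  cg : Fin k → A
  pd_mul_mulHom : ∀ i c, pd i * mulHom c = mulHom c * pd i + mulHom (der i c)
  pd_comm : ∀ i j, pd i * pd j = pd j * pd i
  der_cg : ∀ i j, der i (cg j) = if i = j then 1 else 0
  adjoin_eq_top : Algebra.adjoin ℂ (Set.range mulHom ∪ Set.range pd) = ⊤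

/-- The weight of a list of indices, the index `h : Fin k` having weight `h + 1`. -/
def wt {k : ℕ} (l : List (Fin k)) : ℕ := (l.map fun h : Fin k => (h : ℕ) + 1).sum

/-! ### Order and weight of lists of indices -/

section Weight

variable {k : ℕ}

@[simp] theorem wt_nil : wt ([] : List (Fin k)) = 0 := rfl

@[simp] theorem wt_cons (i : Fin k) (l : List (Fin k)) : wt (i :: l) = i + 1 + wt l := by
  simp [wt]

theorem wt_perm {l l' : List (Fin k)} (h : l.Perm l') : wt l = wt l' := by
  exact List.Perm.sum_eq (h.map fun i : Fin k => (i : ℕ) + 1)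

theorem length_le_wt (l : List (Fin k)) : l.length ≤ wt l := by
  induction l with
  | nil => simp
  | cons i l ih => simp; omega

theorem wt_le (l : List (Fin k)) : wt l ≤ k * l.length := by
  induction l with
  | nil => simp
  | cons i l ih => simp [mul_add]; omega

theorem exists_lt_of_wt_lt (l : List (Fin k)) (h : wt l < k * l.length) :
    ∃ c : Fin k, ∃ l' : List (Fin k), (c : ℕ) + 1 < k ∧ l.Perm (c :: l') := by
  induction l with
  | nil => simp at h
  | cons i l ih =>
    by_cases hi : (i : ℕ) + 1 < k
    · exact ⟨i, l, hi, List.Perm.refl _⟩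
    · obtain ⟨c, l', hc, hl⟩ := ih (by simp [mul_add] at h; omega)
      exact ⟨c, i :: l', hc, (hl.cons i).trans (List.Perm.swap _ _ _)⟩

/-- Weight equals length only when every index is the first one. The index found here is the ∂_m, m
≥ 2, to which T^m applies. -/
theorem exists_pos_of_length_lt_wt (l : List (Fin k)) (h : l.length < wt l) :
    ∃ c : Fin k, ∃ l' : List (Fin k), 0 < (c : ℕ) ∧ l.Perm (c :: l') := by
  induction l with
  | nil => simp at h
  | cons i l ih =>
    by_cases hi : 0 < (i : ℕ)
    · exact ⟨i, l, hi, List.Perm.refl _⟩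
    · obtain ⟨c, l', hc, hl⟩ := ih (by simp at h; omega)
      exact ⟨c, i :: l', hc, (hl.cons i).trans (List.Perm.swap _ _ _)⟩

end Weight

namespace Frame

variable {k : ℕ} {A D : Type*} [CommRing A] [Algebra ℂ A] [Ring D] [Algebra ℂ D] (W : Frame k A D)

/-- The product of the partial derivatives along a list of indices. -/
def mon (l : List (Fin k)) : D := (l.map W.pd).prod

/-- The Euler field. -/
def euler : D := ∑ h : Fin k, W.mulHom (W.cg h) * W.pd h

/-- The operators `∂_p ∂_q - ∂_{p+1} ∂_{q-1}`. -/
def opsA : Set D :=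
  {Q | ∃ p p' q q' : Fin k, (p' : ℕ) = p + 1 ∧ (q : ℕ) = q' + 1 ∧
    Q = W.pd p * W.pd q - W.pd p' * W.pd q'}

/-- The operators `∂_1 ∂_{m-1} + ∂_m (E + μ)`. -/
def opsT (μ : ℂ) : Set D :=
  {Q | ∃ o m m' : Fin k, (o : ℕ) = 0 ∧ (m : ℕ) = m' + 1 ∧
    Q = W.pd o * W.pd m' + W.pd m * (W.euler + algebraMap ℂ D μ)}

/-- The left ideal generated by the two families of operators. -/
def idealI (μ : ℂ) : Ideal D := Ideal.span (W.opsA ∪ W.opsT μ)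

@[simp] theorem mon_nil : W.mon [] = 1 := rfl

@[simp] theorem mon_cons (i : Fin k) (l : List (Fin k)) :
    W.mon (i :: l) = W.pd i * W.mon l := by
  simp [mon]

theorem mon_perm {l l' : List (Fin k)} (h : l.Perm l') : W.mon l = W.mon l' := by
  induction h with
  | nil => rfl
  | cons a _ ih => simp [ih]
  | swap a b l => simp [← mul_assoc, W.pd_comm a b]
  | trans _ _ ih1 ih2 => exact ih1.trans ih2

theorem mon_mul_pd (l : List (Fin k)) (i : Fin k) : W.mon l * W.pd i = W.mon (i :: l) := by
  induction l with
  | nil => simp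
  | cons j l ih =>
    rw [mon_cons, mul_assoc, ih, ← mon_cons]
    exact W.mon_perm (List.Perm.swap _ _ _)

theorem pd_mul_euler (i : Fin k) : W.pd i * W.euler = W.euler * W.pd i + W.pd i := by
  have h : ∀ j : Fin k, W.pd i * (W.mulHom (W.cg j) * W.pd j) =
      W.mulHom (W.cg j) * W.pd j * W.pd i + (if i = j then W.pd j else 0) := by
    intro j
    rw [← mul_assoc, W.pd_mul_mulHom, W.der_cg, add_mul, mul_assoc, W.pd_comm i j, ← mul_assoc]
    split_ifs <;> simp
  simp only [euler, Finset.mul_sum, Finset.sum_mul, h, Finset.sum_add_distrib]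
  simp

/-- Since [∂_i, E] = ∂_i, the commutator counts the order. This is the source of the factors μ + n
that must not vanish. -/
theorem mon_mul_euler (l : List (Fin k)) :
    W.mon l * W.euler = W.euler * W.mon l + algebraMap ℂ D (l.length : ℂ) * W.mon l := by
  induction l with
  | nil => simp
  | cons i l ih =>
    rw [mon_cons, mul_assoc, ih, mul_add, ← mul_assoc, pd_mul_euler, add_mul, mul_assoc,
      ← mul_assoc (W.pd i), ← Algebra.commutes, mul_assoc]
    simp only [List.length_cons, Nat.cast_add, Nat.cast_one, map_add, map_one, add_mul, one_mul]
    abel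

/-! ### Monomials modulo the ideal -/

theorem mon_shift_mem (μ : ℂ) {p p' q q' : Fin k} (hp : (p' : ℕ) = p + 1) (hq : (q : ℕ) = q' + 1)
    (l : List (Fin k)) : W.mon (p :: q :: l) - W.mon (p' :: q' :: l) ∈ W.idealI μ := by
  have h : W.pd p * W.pd q - W.pd p' * W.pd q' ∈ W.idealI μ :=
    Ideal.subset_span (Or.inl ⟨p, p', q, q', hp, hq, rfl⟩)
  have := (W.idealI μ).mul_mem_left (W.mon l) h
  rwa [mul_sub, ← mul_assoc, mon_mul_pd, mon_mul_pd, ← mul_assoc, mon_mul_pd, mon_mul_pd,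
    W.mon_perm (List.Perm.swap p q l), W.mon_perm (List.Perm.swap p' q' l)] at this

/-- The head is lowered from b to a one unit at a time, each unit being passed to an index of the
tail that is not yet maximal. The bound on the weight says that the tail has room for all n units.
-/
theorem exists_mon_cons_sub_mem (μ : ℂ) (a : Fin k) (n : ℕ) : ∀ (b : Fin k) (l : List (Fin k)),
    (b : ℕ) = a + n → wt (b :: l) ≤ a + 1 + k * l.length →
    ∃ l' : List (Fin k), l'.length = l.length ∧ wt (a :: l') = wt (b :: l) ∧
      W.mon (b :: l) - W.mon (a :: l') ∈ W.idealI μ := by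
  induction n with
  | zero =>
    intro b l hb _
    obtain rfl : b = a := Fin.ext (by simpa using hb)
    exact ⟨l, rfl, rfl, by simp⟩
  | succ n ih =>
    intro b l hb hw
    obtain ⟨c, l₁, hc, hl⟩ := exists_lt_of_wt_lt l (by simp at hw; omega)
    have hlen : l.length = l₁.length + 1 := by simpa using hl.length_eq
    have hwt := wt_perm hl
    obtain ⟨l', h1, h2, h3⟩ := ih ⟨b - 1, by omega⟩ (⟨c + 1, hc⟩ :: l₁) (by simp; omega)
      (by simp at hw hwt ⊢; rw [hlen] at hw; omega)
    refine ⟨l', by simp [h1, hlen], by rw [h2]; simp at hwt ⊢; omega, ?_⟩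
    have h4 := W.mon_shift_mem μ (p := c) (p' := ⟨c + 1, hc⟩) (q := b) (q' := ⟨b - 1, by omega⟩)
      rfl (by simp; omega) l₁
    have h5 : W.mon (b :: l) = W.mon (c :: b :: l₁) :=
      W.mon_perm ((hl.cons b).trans (List.Perm.swap _ _ _))
    have h6 : W.mon (⟨c + 1, hc⟩ :: ⟨b - 1, by omega⟩ :: l₁) =
        W.mon (⟨b - 1, by omega⟩ :: ⟨c + 1, hc⟩ :: l₁) := W.mon_perm (List.Perm.swap _ _ _)
    rw [h5]
    rw [h6] at h4
    simpa using add_mem h4 h3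

/-- Modulo the ideal, a monomial depends only on its order and its weight. -/
theorem mon_sub_mon_mem (μ : ℂ) : ∀ (l l' : List (Fin k)), l.length = l'.length → wt l = wt l' →
    W.mon l - W.mon l' ∈ W.idealI μ := by
  intro l
  induction hn : l.length generalizing l with
  | zero =>
    intro l' hl _
    rw [List.length_eq_zero_iff.1 hn, List.length_eq_zero_iff.1 hl.symm]
    simp
  | succ n ih =>
    intro l' hl hw
    obtain ⟨a, l, rfl⟩ := List.exists_cons_of_length_eq_add_one hn
    obtain ⟨b, l', rfl⟩ := List.exists_cons_of_length_eq_add_one hl.symm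
    simp only [List.length_cons, Nat.add_right_cancel_iff] at hn hl
    have hwl := wt_le l
    have hwl' := wt_le l'
    -- The larger head is lowered to the smaller one. There is room because the other list has the
    -- same weight and already carries the smaller head. The tails are then compared by induction.
    rcases le_total (a : ℕ) b with hab | hab
    · obtain ⟨l₁, h1, h2, h3⟩ := W.exists_mon_cons_sub_mem μ a (b - a) b l' (by omega)
        (by rw [← hw, wt_cons, ← hl, ← hn]; omega)
      have h4 := ih l hn l₁ (by omega) (by rw [← hw] at h2; simp at h2; omega)
      have h5 := (W.idealI μ).mul_mem_left (W.pd a) h4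
      rw [mul_sub, ← mon_cons, ← mon_cons] at h5
      simpa using sub_mem h5 h3
    · obtain ⟨l₁, h1, h2, h3⟩ := W.exists_mon_cons_sub_mem μ b (a - b) a l (by omega)
        (by rw [hw, wt_cons, hn, hl]; omega)
      have h4 := ih l₁ (by omega) l' (by omega) (by rw [hw] at h2; simp at h2; omega)
      have h5 := (W.idealI μ).mul_mem_left (W.pd b) h4
      rw [mul_sub, ← mon_cons, ← mon_cons] at h5
      simpa using add_mem h3 h5

open Classical in
/-- A monomial of order `p` and weight `q`, or `0` if there is none. -/
def rep (p q : ℕ) : D :=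
  if h : ∃ l : List (Fin k), l.length = p ∧ wt l = q then W.mon h.choose else 0

theorem rep_eq (p q : ℕ) : (∃ l : List (Fin k), l.length = p ∧ wt l = q ∧ W.rep p q = W.mon l) ∨
    ((¬ ∃ l : List (Fin k), l.length = p ∧ wt l = q) ∧ W.rep p q = 0) := by
  unfold rep
  split_ifs with h
  · exact Or.inl ⟨_, h.choose_spec.1, h.choose_spec.2, rfl⟩
  · exact Or.inr ⟨h, rfl⟩

theorem mon_sub_rep_mem (μ : ℂ) (l : List (Fin k)) :
    W.mon l - W.rep l.length (wt l) ∈ W.idealI μ := by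
  rcases W.rep_eq l.length (wt l) with ⟨l', h1, h2, h3⟩ | ⟨h, _⟩
  · rw [h3]
    exact W.mon_sub_mon_mem μ _ _ h1.symm h2.symm
  · exact absurd ⟨l, rfl, rfl⟩ h

/-! ### Normal forms modulo the ideal -/

/-- The candidates for a normal form: a combination of `∂_1 ^ p` for `p < d` and of monomials of
order `d`. -/
def normalForm (d : ℕ) (c e : ℕ → A) : D :=
  ∑ p ∈ Finset.range d, W.mulHom (c p) * W.rep p p +
    ∑ q ∈ Finset.range (k * d + 1), W.mulHom (e q) * W.rep d q

/-- The operators that have a normal form of order `d`. -/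
def reducible (μ : ℂ) (d : ℕ) : AddSubgroup D where
  carrier := {Q | ∃ c e : ℕ → A, Q - W.normalForm d c e ∈ W.idealI μ}
  zero_mem' := ⟨0, 0, by simp [normalForm]⟩
  add_mem' := by
    rintro P Q ⟨c, e, h⟩ ⟨c', e', h'⟩
    refine ⟨c + c', e + e', ?_⟩
    have : W.normalForm d (c + c') (e + e') = W.normalForm d c e + W.normalForm d c' e' := by
      simp only [normalForm, Pi.add_apply, map_add, add_mul, Finset.sum_add_distrib]
      abel
    rw [this, add_sub_add_comm]
    exact add_mem h h'
  neg_mem' := by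
    rintro P ⟨c, e, h⟩
    refine ⟨-c, -e, ?_⟩
    have : W.normalForm d (-c) (-e) = -W.normalForm d c e := by
      simp only [normalForm, Pi.neg_apply, map_neg, neg_mul, Finset.sum_neg_distrib]
      abel
    rw [this, ← neg_sub']
    exact neg_mem h

variable {W} {μ : ℂ} {d : ℕ}

theorem reducible_of_mem {Q : D} (h : Q ∈ W.idealI μ) : Q ∈ W.reducible μ d :=
  ⟨0, 0, by simpa [normalForm] using h⟩

theorem reducible_congr {P Q : D} (h : P - Q ∈ W.idealI μ) (hQ : Q ∈ W.reducible μ d) :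
    P ∈ W.reducible μ d := by
  simpa using add_mem (reducible_of_mem (d := d) h) hQ

theorem mulHom_mul_mem (a : A) {Q : D} (h : Q ∈ W.reducible μ d) :
    W.mulHom a * Q ∈ W.reducible μ d := by
  obtain ⟨c, e, h⟩ := h
  refine ⟨fun p => a * c p, fun q => a * e q, ?_⟩
  have : W.normalForm d (fun p => a * c p) (fun q => a * e q) =
      W.mulHom a * W.normalForm d c e := by
    simp only [normalForm, map_mul, mul_add, Finset.mul_sum, mul_assoc]
  rw [this, ← mul_sub]
  exact (W.idealI μ).mul_mem_left _ h

theorem rep_diag_mem {p : ℕ} (hp : p < d) : W.rep p p ∈ W.reducible μ d := by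
  refine ⟨Pi.single p 1, 0, ?_⟩
  have : W.normalForm d (Pi.single p 1) 0 = W.rep p p := by
    rw [normalForm, Finset.sum_eq_single_of_mem p (Finset.mem_range.2 hp)]
    · simp
    · intro b _ hb
      simp [Pi.single_eq_of_ne hb]
  simp [this]

theorem rep_top_mem (q : ℕ) : W.rep d q ∈ W.reducible μ d := by
  rcases W.rep_eq d q with ⟨l, rfl, rfl, h3⟩ | ⟨_, h⟩
  · refine ⟨0, Pi.single (wt l) 1, ?_⟩
    have : W.normalForm l.length 0 (Pi.single (wt l) 1) = W.rep l.length (wt l) := by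
      -- Each index weighs at most k, so the range of weights in `normalForm` is large enough.
      have hq : wt l ∈ Finset.range (k * l.length + 1) :=
        Finset.mem_range.2 (Nat.lt_succ_of_le (wt_le l))
      rw [normalForm, Finset.sum_eq_single_of_mem _ hq]
      · simp
      · intro b _ hb
        simp [Pi.single_eq_of_ne hb]
    simp [this]
  · rw [h]
    exact zero_mem _

theorem reducible_le {H : AddSubgroup D} (hI : ∀ Q ∈ W.idealI μ, Q ∈ H)
    (h1 : ∀ p < d, ∀ c, W.mulHom c * W.rep p p ∈ H) (h2 : ∀ q c, W.mulHom c * W.rep d q ∈ H) :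
    W.reducible μ d ≤ H := by
  rintro Q ⟨c, e, h⟩
  have h3 : W.normalForm d c e ∈ H :=
    add_mem (sum_mem fun p hp => h1 p (Finset.mem_range.1 hp) _) (sum_mem fun q _ => h2 q _)
  simpa using add_mem (hI _ h) h3

theorem mon_mem_reducible_length (l : List (Fin k)) : W.mon l ∈ W.reducible μ l.length :=
  reducible_congr (W.mon_sub_rep_mem μ l) (rep_top_mem _)

/-- Only the last term has order |l| + 1, all others having order |l| + 2. Modulo the ideal the
relation can thus be solved for the lower-order monomial once its scalar is nonzero. -/
theorem mon_mul_opT_eq {o m m' : Fin k} (l : List (Fin k)) :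
    W.mon l * (W.pd o * W.pd m' + W.pd m * (W.euler + algebraMap ℂ D μ)) =
      W.mon (o :: m' :: l) + ∑ h : Fin k, W.mulHom (W.cg h) * W.mon (h :: m :: l) +
        algebraMap ℂ D (μ + (m :: l).length) * W.mon (m :: l) := by
  have h1 : W.euler * W.mon (m :: l) =
      ∑ h : Fin k, W.mulHom (W.cg h) * W.mon (h :: m :: l) := by
    simp only [euler, Finset.sum_mul, mul_assoc, ← mon_cons]
  have h2 : W.mon (m' :: o :: l) = W.mon (o :: m' :: l) := W.mon_perm (List.Perm.swap _ _ _)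
  rw [mul_add, ← mul_assoc, mon_mul_pd, mon_mul_pd, ← mul_assoc, mon_mul_pd, mul_add,
    mon_mul_euler, h1, h2, ← Algebra.commutes, map_add, add_mul]
  abel

theorem mon_mem_reducible_succ (hμ : ∀ n : ℕ, μ ≠ -(n : ℂ)) (l : List (Fin k)) :
    W.mon l ∈ W.reducible μ (l.length + 1) := by
  -- In the case of equality the monomial is a power of ∂_1, already allowed below the top order.
  rcases (length_le_wt l).eq_or_lt with h | h
  · have h1 := W.mon_sub_rep_mem μ l
    rw [← h] at h1
    exact reducible_congr h1 (rep_diag_mem (Nat.lt_succ_self _))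
  · obtain ⟨m, l', hm, hl⟩ := exists_pos_of_length_lt_wt l h
    rw [W.mon_perm hl, hl.length_eq]
    have hT := (W.idealI μ).mul_mem_left (W.mon l') (Ideal.subset_span (Or.inr
      ⟨⟨0, by omega⟩, m, ⟨m - 1, by omega⟩, rfl, by simp; omega, rfl⟩))
    rw [mon_mul_opT_eq] at hT
    set S : D := W.mon (⟨0, by omega⟩ :: ⟨m - 1, by omega⟩ :: l') +
      ∑ h : Fin k, W.mulHom (W.cg h) * W.mon (h :: m :: l')
    have hS : S ∈ W.reducible μ ((m :: l').length + 1) :=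
      add_mem (mon_mem_reducible_length (⟨0, by omega⟩ :: ⟨m - 1, by omega⟩ :: l'))
        (sum_mem fun h _ => mulHom_mul_mem _ (mon_mem_reducible_length (h :: m :: l')))
    have h3 : algebraMap ℂ D (μ + (m :: l').length) * W.mon (m :: l') ∈
        W.reducible μ ((m :: l').length + 1) := by
      simpa using sub_mem (reducible_of_mem hT) hS
    have hne : μ + ((m :: l').length : ℂ) ≠ 0 := fun h0 => hμ _ (eq_neg_of_add_eq_zero_left h0)
    have h4 := mulHom_mul_mem (algebraMap ℂ A (μ + ((m :: l').length : ℂ))⁻¹) h3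
    rwa [AlgHom.commutes, ← mul_assoc, ← map_mul, inv_mul_cancel₀ hne, map_one, one_mul] at h4

theorem reducible_mono (hμ : ∀ n : ℕ, μ ≠ -(n : ℂ)) : Monotone (W.reducible μ) := by
  refine monotone_nat_of_le_succ fun d => ?_
  refine reducible_le (fun Q => reducible_of_mem)
    (fun p hp c => mulHom_mul_mem c (rep_diag_mem (hp.trans (Nat.lt_succ_self _))))
    (fun q c => mulHom_mul_mem c ?_)
  rcases W.rep_eq d q with ⟨l, rfl, rfl, h3⟩ | ⟨_, h⟩
  · rw [h3]
    exact mon_mem_reducible_succ hμ l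
  · rw [h]
    exact zero_mem _

theorem pd_mul_mem (hμ : ∀ n : ℕ, μ ≠ -(n : ℂ)) (i : Fin k) {Q : D}
    (hQ : Q ∈ W.reducible μ d) : W.pd i * Q ∈ W.reducible μ (d + 1) := by
  have key : ∀ p q : ℕ, p ≤ d → ∀ c : A,
      W.pd i * (W.mulHom c * W.rep p q) ∈ W.reducible μ (d + 1) := by
    intro p q hp c
    rw [← mul_assoc, W.pd_mul_mulHom, add_mul, mul_assoc]
    rcases W.rep_eq p q with ⟨l, rfl, rfl, h3⟩ | ⟨_, h⟩
    · rw [h3, ← mon_cons]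
      exact add_mem
        (mulHom_mul_mem _ (reducible_mono hμ (by simpa using hp) (mon_mem_reducible_length _)))
        (mulHom_mul_mem _ (reducible_mono hμ (by omega) (mon_mem_reducible_length _)))
    · simp only [h, mul_zero, add_zero]
      exact zero_mem _
  exact reducible_le (H := (W.reducible μ (d + 1)).comap (AddMonoidHom.mulLeft (W.pd i)))
    (fun P hP => reducible_of_mem ((W.idealI μ).mul_mem_left _ hP))
    (fun p hp c => key p p hp.le c) (fun q c => key d q le_rfl c) hQ

theorem exists_mem_reducible (W : Frame k A D) (hμ : ∀ n : ℕ, μ ≠ -(n : ℂ)) (Q : D) :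
    ∃ d, Q ∈ W.reducible μ d := by
  -- Stated as stability under left multiplication by Q, the claim passes to products of generators.
  -- Taking P = 1 recovers it.
  suffices H : ∀ d, ∀ P ∈ W.reducible μ d, ∃ d', Q * P ∈ W.reducible μ d' by
    simpa using H 0 1 (mon_mem_reducible_length [])
  have hQ : Q ∈ Algebra.adjoin ℂ (Set.range W.mulHom ∪ Set.range W.pd) := by
    rw [W.adjoin_eq_top]
    trivial
  induction hQ using Algebra.adjoin_induction with
  | mem Q h =>
    intro d P hP
    rcases h with ⟨c, rfl⟩ | ⟨i, rfl⟩
    · exact ⟨d, mulHom_mul_mem c hP⟩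
    · exact ⟨d + 1, pd_mul_mem hμ i hP⟩
  | algebraMap r =>
    intro d P hP
    rw [← W.mulHom.commutes]
    exact ⟨d, mulHom_mul_mem _ hP⟩
  | add Q Q' _ _ h h' =>
    intro d P hP
    obtain ⟨d1, h1⟩ := h d P hP
    obtain ⟨d2, h2⟩ := h' d P hP
    refine ⟨max d1 d2, ?_⟩
    rw [add_mul]
    exact add_mem (reducible_mono hμ (le_max_left _ _) h1) (reducible_mono hμ (le_max_right _ _) h2)
  | mul Q Q' _ _ h h' =>
    intro d P hP
    obtain ⟨d1, h1⟩ := h' d P hP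
    obtain ⟨d2, h2⟩ := h d1 _ h1
    exact ⟨d2, by rwa [mul_assoc]⟩

end Frame

universe u

namespace Frame

/-! ### Action on families of powers -/

section Family

variable {k : ℕ} {A D : Type*} [CommRing A] [Algebra ℂ A] [Ring D] [Algebra ℂ D] (W : Frame k A D)

/-- The polynomial `1 + ∑ (-1)^h σ_h X^h`. -/
def unitPoly : Polynomial A :=
  1 + ∑ h : Fin k, Polynomial.C ((-1) ^ ((h : ℕ) + 1) * W.cg h) * Polynomial.X ^ ((h : ℕ) + 1)

/-- A family `F j` that behaves under `D` as the powers `u ^ (-μ - j)` of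
`u = 1 + ∑ (-1)^h σ_h z^h`. -/
structure PowerFamily {B : Type*} [CommRing B] [Algebra ℂ B] [Algebra A B] [Module D B]
    (μ : ℂ) (z : B) (F : ℕ → B) : Prop where
  mulHom_smul : ∀ c b, W.mulHom c • b = algebraMap A B c * b
  pd_smul : ∀ (i : Fin k) (n j : ℕ) (r : ℂ), W.pd i • (r • (z ^ n * F j)) =
    (r * (-(μ + j) * (-1) ^ ((i : ℕ) + 1))) • (z ^ (n + ((i : ℕ) + 1)) * F (j + 1))
  step : ∀ j, Polynomial.aeval z W.unitPoly * F (j + 1) = F j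

/-- The rising factorial `μ (μ + 1) ⋯ (μ + p - 1)`. -/
def rising (μ : ℂ) (p : ℕ) : ℂ := ∏ j ∈ Finset.range p, (μ + j)

theorem rising_ne_zero {μ : ℂ} (hμ : ∀ n : ℕ, μ ≠ -(n : ℂ)) (p : ℕ) : rising μ p ≠ 0 :=
  Finset.prod_ne_zero_iff.2 fun j _ h => hμ j (eq_neg_of_add_eq_zero_left h)

open Classical in
/-- The scalar by which the representative of order `p` and weight `q` acts. -/
def repCoeff (k : ℕ) (μ : ℂ) (p q : ℕ) : ℂ :=
  if ∃ l : List (Fin k), l.length = p ∧ wt l = q then (-1) ^ (p + q) * rising μ p else 0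

/-- The polynomial in `z` by which a normal form acts on a family of powers. -/
def symbol (μ : ℂ) (d : ℕ) (c e : ℕ → A) : Polynomial A :=
  ∑ p ∈ Finset.range d, Polynomial.C (repCoeff k μ p p • c p) *
      (Polynomial.X ^ p * W.unitPoly ^ (d - p)) +
    ∑ q ∈ Finset.range (k * d + 1), Polynomial.C (repCoeff k μ d q • e q) * Polynomial.X ^ q

variable {W} {B : Type*} [CommRing B] [Algebra ℂ B] [Algebra A B] [Module D B]
  {μ : ℂ} {z : B} {F : ℕ → B}

theorem PowerFamily.mon_smul (hF : W.PowerFamily μ z F) (l : List (Fin k)) :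
    W.mon l • F 0 = ((-1) ^ (l.length + wt l) * rising μ l.length) • (z ^ wt l * F l.length) := by
  induction l with
  | nil => simp [rising]
  | cons i l ih =>
    rw [mon_cons, mul_smul, ih, hF.pd_smul, wt_cons, List.length_cons, rising, rising,
      Finset.prod_range_succ, add_comm (wt l)]
    congr 1
    ring

theorem PowerFamily.rep_smul (hF : W.PowerFamily μ z F) (p q : ℕ) :
    W.rep p q • F 0 = repCoeff k μ p q • (z ^ q * F p) := by
  rcases W.rep_eq p q with ⟨l, rfl, rfl, h⟩ | ⟨h, h'⟩
  · rw [h, hF.mon_smul, repCoeff, if_pos ⟨l, rfl, rfl⟩]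
  · rw [h', repCoeff, if_neg h, zero_smul, zero_smul]

theorem PowerFamily.unitPoly_pow_mul (hF : W.PowerFamily μ z F) (n p : ℕ) :
    Polynomial.aeval z W.unitPoly ^ n * F (p + n) = F p := by
  induction n with
  | zero => simp
  | succ n ih => rw [pow_succ, mul_assoc, ← add_assoc, hF.step, ih]

variable [IsScalarTower ℂ A B]

/-- The terms of order p < d produce F p, brought to the common F d by the factor u^(d-p). -/
theorem PowerFamily.normalForm_smul (hF : W.PowerFamily μ z F) (d : ℕ) (c e : ℕ → A) :
    W.normalForm d c e • F 0 = Polynomial.aeval z (W.symbol μ d c e) * F d := by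
  simp only [normalForm, symbol, add_smul, Finset.sum_smul, mul_smul, hF.rep_smul, hF.mulHom_smul,
    map_add, map_sum, map_mul, Polynomial.aeval_C, map_pow, Polynomial.aeval_X, add_mul,
    Finset.sum_mul]
  congr 1
  · refine Finset.sum_congr rfl fun p hp => ?_
    have h := hF.unitPoly_pow_mul (d - p) p
    rw [Nat.add_sub_cancel' (Finset.mem_range.1 hp).le] at h
    rw [← h]
    simp only [Algebra.smul_def, map_mul, ← IsScalarTower.algebraMap_apply]
    ring
  · refine Finset.sum_congr rfl fun p hp => ?_
    simp only [Algebra.smul_def, map_mul, ← IsScalarTower.algebraMap_apply]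
    ring

/-- From E u = u - 1 one gets E u^(-μ) = -μ u^(-μ) + μ u^(-μ-1). -/
theorem PowerFamily.euler_add_smul (hF : W.PowerFamily μ z F) :
    (W.euler + algebraMap ℂ D μ) • F 0 = μ • F 1 := by
  have h0 : ∀ h : Fin k, W.pd h • F 0 = (-μ * (-1) ^ ((h : ℕ) + 1)) • (z ^ ((h : ℕ) + 1) * F 1) := by
    intro h
    simpa using hF.pd_smul h 0 0 1
  rw [add_smul, euler, Finset.sum_smul, ← W.mulHom.commutes, hF.mulHom_smul,
    ← IsScalarTower.algebraMap_apply]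
  simp only [mul_smul (W.mulHom _), hF.mulHom_smul, h0]
  rw [← hF.step 0]
  simp only [unitPoly, map_add, map_one, map_sum, map_mul,
    Polynomial.aeval_C, map_pow, map_neg, Polynomial.aeval_X, add_mul, one_mul, mul_add,
    Algebra.smul_def, Finset.sum_mul, Finset.mul_sum, zero_add]
  rw [add_left_comm, ← Finset.sum_add_distrib, Finset.sum_eq_zero, add_zero]
  intro h _
  ring

/-- The annihilator of F 0 is a left ideal, so generators suffice. In A_{p,q} both monomials have
the same order and weight. In T^m the two terms contribute ±μ(μ+1) z^m F 2 with opposite signs. -/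
theorem PowerFamily.smul_eq_zero (hF : W.PowerFamily μ z F) {Q : D} (hQ : Q ∈ W.idealI μ) :
    Q • F 0 = 0 := by
  have hle : W.idealI μ ≤ LinearMap.ker (LinearMap.toSpanSingleton D B (F 0)) := by
    refine Ideal.span_le.2 ?_
    rintro Q (⟨p, p', q, q', hp, hq, rfl⟩ | ⟨o, m, m', ho, hm, rfl⟩)
    · have h1 := hF.mon_smul [p, q]
      have h2 := hF.mon_smul [p', q']
      have hw : wt [p', q'] = wt [p, q] := by simp; omega
      simp only [mon_cons, mon_nil, mul_one] at h1 h2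
      simp only [SetLike.mem_coe, LinearMap.mem_ker, LinearMap.toSpanSingleton_apply, sub_smul,
        h1, h2, hw]
      simp
    · have h1 := hF.mon_smul [o, m']
      have h2 := hF.pd_smul m 0 1 μ
      have hw : wt [o, m'] = m + 1 := by simp; omega
      simp only [mon_cons, mon_nil, mul_one] at h1
      simp only [SetLike.mem_coe, LinearMap.mem_ker, LinearMap.toSpanSingleton_apply, add_smul,
        h1, mul_smul (W.pd m)]
      rw [← add_smul, hF.euler_add_smul]
      simp only [pow_zero, one_mul] at h2
      rw [h2, hw]
      simp only [List.length_cons, List.length_nil, zero_add, Nat.reduceAdd, ← add_smul]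
      convert zero_smul ℂ _
      simp [rising, Finset.prod_range_succ]
      ring
  exact hle hQ

end Family

/-! ### A normal form is determined by its symbol -/

section Symbol

variable {k : ℕ} {A : Type u} {D : Type*} [CommRing A] [Algebra ℂ A] [Ring D] [Algebra ℂ D] {W : Frame k A D}
  {μ : ℂ}

theorem coeff_zero_unitPoly_pow (n : ℕ) : (W.unitPoly ^ n).coeff 0 = 1 := by
  rw [Polynomial.coeff_zero_eq_eval_zero, Polynomial.eval_pow]
  simp [unitPoly, Polynomial.eval_finsetSum]

theorem repCoeff_of_lt {p q : ℕ} (h : q < p) : repCoeff k μ p q = 0 := by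
  refine if_neg ?_
  rintro ⟨l, rfl, rfl⟩
  exact absurd (length_le_wt l) (by omega)

theorem rep_eq_zero_of_repCoeff (hμ : ∀ n : ℕ, μ ≠ -(n : ℂ)) {p q : ℕ}
    (h : repCoeff k μ p q = 0) : W.rep p q = 0 := by
  rcases W.rep_eq p q with ⟨l, rfl, rfl, _⟩ | ⟨_, h'⟩
  · rw [repCoeff, if_pos ⟨l, rfl, rfl⟩] at h
    exact absurd h (mul_ne_zero (by simp) (rising_ne_zero hμ _))
  · exact h'

theorem mulHom_mul_rep_eq_zero (hμ : ∀ n : ℕ, μ ≠ -(n : ℂ)) {p q : ℕ} {c : A}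
    (h : repCoeff k μ p q • c = 0) : W.mulHom c * W.rep p q = 0 := by
  by_cases h0 : repCoeff k μ p q = 0
  · rw [rep_eq_zero_of_repCoeff hμ h0, mul_zero]
  · rw [(smul_eq_zero_iff_right h0).1 h, map_zero, zero_mul]

/-- The system is triangular. Monomials of order d have weight at least d, so the degrees p < d of
the symbol see only the ∂_1^p, through X^p u^(d-p) = X^p + higher terms. Once these vanish, the
remaining coefficients are read off directly. -/
theorem normalForm_eq_zero (hμ : ∀ n : ℕ, μ ≠ -(n : ℂ)) {d : ℕ} {c e : ℕ → A}
    (h : W.symbol μ d c e = 0) : W.normalForm d c e = 0 := by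
  have hc : ∀ p, p < d → repCoeff k μ p p • c p = 0 := by
    intro p
    induction p using Nat.strong_induction_on with
    | _ p ih =>
      intro hp
      have h1 := congrArg (fun G => Polynomial.coeff G p) h
      simp only [symbol, Polynomial.coeff_add, Polynomial.finsetSum_coeff, Polynomial.coeff_zero,
        Polynomial.coeff_C_mul, Polynomial.coeff_X_pow_mul', Polynomial.coeff_X_pow] at h1
      rw [Finset.sum_eq_single_of_mem p (Finset.mem_range.2 hp), Finset.sum_eq_zero] at h1
      · rwa [if_pos le_rfl, Nat.sub_self, coeff_zero_unitPoly_pow, mul_one, add_zero] at h1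
      · intro q _
        split_ifs with hq
        · rw [repCoeff_of_lt (hq ▸ hp), zero_smul, zero_mul]
        · simp
      · intro b hb hbp
        rcases lt_or_gt_of_ne hbp with h2 | h2
        · rw [ih b h2 (Finset.mem_range.1 hb), zero_mul]
        · rw [if_neg (by omega), mul_zero]
  have he : ∀ q ∈ Finset.range (k * d + 1), repCoeff k μ d q • e q = 0 := by
    intro q hq
    have h1 := congrArg (fun G => Polynomial.coeff G q) h
    rw [symbol, Finset.sum_eq_zero, zero_add] at h1
    · simp only [Polynomial.finsetSum_coeff, Polynomial.coeff_zero, Polynomial.coeff_C_mul,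
        Polynomial.coeff_X_pow] at h1
      rw [Finset.sum_eq_single_of_mem q hq] at h1
      · simpa using h1
      · intro b _ hb
        rw [if_neg hb.symm, mul_zero]
    · intro p hp
      rw [hc p (Finset.mem_range.1 hp), map_zero, zero_mul]
  rw [normalForm, Finset.sum_eq_zero, Finset.sum_eq_zero, add_zero]
  · exact fun q hq => mulHom_mul_rep_eq_zero hμ (he q hq)
  · exact fun p hp => mulHom_mul_rep_eq_zero hμ (hc p (Finset.mem_range.1 hp))

/-- Every operator acts on all families of powers through a polynomial in `z`, and it lies in the
ideal when this polynomial vanishes. -/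
theorem exists_symbol (W : Frame k A D) (hμ : ∀ n : ℕ, μ ≠ -(n : ℂ)) (Q : D) :
    ∃ (d : ℕ) (G : Polynomial A), (G = 0 → Q ∈ W.idealI μ) ∧
      ∀ {B : Type u} [CommRing B] [Algebra ℂ B] [Algebra A B] [IsScalarTower ℂ A B] [Module D B]
        {z : B} {F : ℕ → B}, W.PowerFamily μ z F → Q • F 0 = Polynomial.aeval z G * F d := by
  obtain ⟨d, c, e, h⟩ := W.exists_mem_reducible hμ Q
  refine ⟨d, W.symbol μ d c e, fun h0 => ?_, fun {B} _ _ _ _ _ z F hF => ?_⟩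
  · simpa [normalForm_eq_zero hμ h0] using h
  · have h1 := hF.smul_eq_zero h
    rwa [sub_smul, sub_eq_zero, hF.normalForm_smul] at h1

end Symbol

end Frame

theorem isUnit_of_mul_eq_one_comm {A : Type*} [CommRing A] {a b : A} (h : a * b = 1) :
    IsUnit a :=
  ⟨⟨a, b, h, by rw [mul_comm, h]⟩, rfl⟩

/-- A polynomial over a complex algebra that vanishes at infinitely many scalars is zero. -/
theorem polynomial_eq_zero_of_infinite {A : Type*} [CommRing A] [Algebra ℂ A] {G : Polynomial A}
    {S : Set ℂ} (hS : S.Infinite)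
    (h : ∀ s ∈ S, Polynomial.aeval (algebraMap ℂ A s) G = 0) : G = 0 := by
  ext n
  -- Linear forms separate the points of the complex vector space A. Applying one to the
  -- coefficients gives a complex polynomial with infinitely many roots, so A need not be a domain.
  rw [Polynomial.coeff_zero, ← Module.forall_dual_apply_eq_zero_iff ℂ]
  intro φ
  have key : (∑ i ∈ Finset.range (G.natDegree + 1),
      Polynomial.C (φ (G.coeff i)) * Polynomial.X ^ i : Polynomial ℂ) = 0 := by
    refine Polynomial.eq_zero_of_infinite_isRoot _ (hS.mono fun s hs => ?_)
    have h1 := congrArg φ (h s hs)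
    rw [Polynomial.aeval_eq_sum_range] at h1
    rw [Set.mem_ofPred_eq, Polynomial.IsRoot, Polynomial.eval_finsetSum, ← h1.trans (map_zero φ),
      map_sum]
    refine Finset.sum_congr rfl fun i _ => ?_
    rw [← map_pow, smul_eq_mul, mul_comm (G.coeff i), ← Algebra.smul_def, map_smul,
      smul_eq_mul, Polynomial.eval_mul, Polynomial.eval_C, Polynomial.eval_pow, Polynomial.eval_X,
      mul_comm]
  by_cases hn : n ∈ Finset.range (G.natDegree + 1)
  · have h2 := congrArg (fun P => Polynomial.coeff P n) key
    simpa [Polynomial.finsetSum_coeff, Polynomial.coeff_X_pow, Finset.mem_range.1 hn] using h2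
  · rw [Polynomial.coeff_eq_zero_of_natDegree_lt (by simpa using hn), map_zero]

/-! ### Germs of holomorphic differential operators -/

section Germ

variable {k : ℕ} {x : Fin k → ℂ}

instance : Ring (DiffOp k x) := (DiffOp k x).toRing

instance instModuleHolGerm : Module (DiffOp k x) (HolGerm k x) :=
  Module.compHom _ (DiffOp k x).val.toRingHom

instance : SMul (DiffOp k x) (HolGerm k x) :=
  instModuleHolGerm.toDistribMulAction.toMulAction.toSMul

/-- Multiplication by a germ, as a differential operator of order `0`. -/
def germMul (k : ℕ) (x : Fin k → ℂ) : HolGerm k x →ₐ[ℂ] DiffOp k x :=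
  (Algebra.lmul ℂ (HolGerm k x)).codRestrict (DiffOp k x)
    fun c => Algebra.subset_adjoin (Or.inl ⟨c, rfl⟩)

/-- The germ of the coordinate function of index `i`. -/
def coordGerm (x : Fin k → ℂ) (i : Fin k) : HolGerm k x :=
  germAt (fun σ => σ i)
    ((ContinuousLinearMap.proj (R := ℂ) (φ := fun _ : Fin k => ℂ) i).analyticAt x)

theorem germMul_smul (c g : HolGerm k x) : germMul k x c • g = c * g := rfl

theorem pd_smul_mul (i : Fin k) (f g : HolGerm k x) :
    pd x i • (f * g) = f * pd x i • g + (pd x i • f) * g := by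
  obtain ⟨f, rfl⟩ := Ideal.Quotient.mk_surjective f
  obtain ⟨g, rfl⟩ := Ideal.Quotient.mk_surjective g
  refine mk_eq_of_eventuallyEq (f := partialFun i (f * g))
    (g := f * partialFun i g + partialFun i f * g) ?_
  filter_upwards [AnalyticAt.eventually_analyticAt f.2,
    AnalyticAt.eventually_analyticAt g.2] with y h1 h2
  simp [partialFun, fderiv_mul h1.differentiableAt h2.differentiableAt, mul_comm]

theorem pd_comm (i j : Fin k) : pd x i * pd x j = pd x j * pd x i := by
  apply Subtype.ext
  apply LinearMap.ext
  intro g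
  obtain ⟨f, rfl⟩ := Ideal.Quotient.mk_surjective g
  refine mk_eq_of_eventuallyEq (f := partialFun i (partialFun j f))
    (g := partialFun j (partialFun i f)) ?_
  filter_upwards [AnalyticAt.eventually_analyticAt f.2] with y hy
  have hs : IsSymmSndFDerivAt ℂ (f : (Fin k → ℂ) → ℂ) y :=
    ContDiffAt.isSymmSndFDerivAt_of_omega hy.contDiffAt
  have hd : DifferentiableAt ℂ (fderiv ℂ (f : (Fin k → ℂ) → ℂ)) y := hy.fderiv.differentiableAt
  have key : ∀ a b : Fin k, (partialFun a (partialFun b f) : (Fin k → ℂ) → ℂ) y =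
      fderiv ℂ (fderiv ℂ (f : (Fin k → ℂ) → ℂ)) y (Pi.single a 1) (Pi.single b 1) := by
    intro a b
    simp only [partialFun]
    rw [fderiv_clm_apply hd (differentiableAt_const _)]
    simp
  rw [key, key]
  exact hs _ _

theorem pd_smul_coordGerm (i j : Fin k) :
    pd x i • coordGerm x j = if i = j then 1 else 0 := by
  have h : pd x i • coordGerm x j = algebraMap ℂ (HolGerm k x) (if i = j then 1 else 0) := by
    refine mk_eq_of_eventuallyEq (g := algebraMap ℂ (analyticFun k x) (if i = j then 1 else 0))
      (Eventually.of_forall fun y => ?_)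
    have : HasFDerivAt (fun σ : Fin k → ℂ => σ j)
      (ContinuousLinearMap.proj (R := ℂ) (φ := fun _ : Fin k => ℂ) j) y :=
      (ContinuousLinearMap.proj (R := ℂ) (φ := fun _ : Fin k => ℂ) j).hasFDerivAt
    simp only [partialFun, this.fderiv]
    by_cases hij : i = j
    · subst hij
      simp
    · simp [hij, Ne.symm hij]
  rw [h]
  split_ifs <;> simp

theorem smul_smul_germ (Q : DiffOp k x) (r : ℂ) (g : HolGerm k x) : Q • (r • g) = r • (Q • g) :=
  map_smul (Q : Module.End ℂ (HolGerm k x)) r g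

theorem pd_mul_germMul (i : Fin k) (c : HolGerm k x) :
    pd x i * germMul k x c = germMul k x c * pd x i + germMul k x (pd x i • c) := by
  apply Subtype.ext
  apply LinearMap.ext
  intro g
  exact pd_smul_mul i c g

/-- The stalk is defined by generators inside the endomorphism ring. Here the same generators are
shown to generate it as an algebra in its own right. -/
theorem adjoin_germMul_pd :
    Algebra.adjoin ℂ (Set.range (germMul k x) ∪ Set.range (pd x)) = ⊤ := by
  refine top_unique (le_trans (Algebra.adjoin_adjoin_coe_preimage
    (R := ℂ) (s := Set.range (LinearMap.mulLeft ℂ) ∪ Set.range (partialOp (x := x)))).ge ?_)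
  refine Algebra.adjoin_mono ?_
  rintro ⟨Q, hQ⟩ (⟨c, h⟩ | ⟨i, h⟩)
  · exact Or.inl ⟨c, Subtype.ext h⟩
  · exact Or.inr ⟨i, Subtype.ext h⟩

/-- The frame of the stalk at `x` of the sheaf of holomorphic differential operators. -/
def germFrame (k : ℕ) (x : Fin k → ℂ) : Frame k (HolGerm k x) (DiffOp k x) where
  mulHom := germMul k x
  pd := pd x
  der i c := pd x i • c
  cg := coordGerm x
  pd_mul_mulHom := pd_mul_germMul
  pd_comm := pd_comm
  der_cg := pd_smul_coordGerm
  adjoin_eq_top := adjoin_germMul_pd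

theorem idealI_germFrame (μ : ℂ) : (germFrame k x).idealI μ = idealI μ x := rfl

theorem kills_iff (Q : DiffOp k x) {f : (Fin k → ℂ) → ℂ} (hf : AnalyticAt ℂ f x) :
    Kills Q f ↔ Q • germAt f hf = 0 :=
  ⟨fun h => h.2, fun h => ⟨hf, h⟩⟩

end Germ

/-! ### The functions `(a^k / P_σ(a))^μ` -/

section PowFun

variable {k : ℕ} {x : Fin k → ℂ}

/-- The function `1 + ∑ (-1)^h σ_h z^h`. -/
def unitFun (z : ℂ) (σ : Fin k → ℂ) : ℂ :=
  1 + ∑ h : Fin k, (-1) ^ ((h : ℕ) + 1) * σ h * z ^ ((h : ℕ) + 1)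

theorem powFun_eq {a : ℂ} (ha : a ≠ 0) (μ : ℂ) (σ : Fin k → ℂ) :
    powFun μ a σ = (unitFun a⁻¹ σ)⁻¹ ^ μ := by
  have h : univPoly σ a = a ^ k * unitFun a⁻¹ σ := by
    rw [univPoly, unitFun, mul_add, mul_one, Finset.mul_sum]
    congr 1
    refine Finset.sum_congr rfl fun h _ => ?_
    rw [pow_sub₀ a ha (show (h : ℕ) + 1 ≤ k from h.2), inv_pow]
    ring
  rw [powFun, h, div_mul_cancel_left₀ (pow_ne_zero k ha)]

theorem hasFDerivAt_unitFun (z : ℂ) (σ : Fin k → ℂ) :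
    HasFDerivAt (unitFun z) (∑ h : Fin k, ((-1) ^ ((h : ℕ) + 1) * z ^ ((h : ℕ) + 1)) •
      ContinuousLinearMap.proj (R := ℂ) (φ := fun _ : Fin k => ℂ) h) σ := by
  have : unitFun (k := k) z = fun σ => 1 + ∑ h : Fin k,
      ((-1) ^ ((h : ℕ) + 1) * z ^ ((h : ℕ) + 1)) •
        ContinuousLinearMap.proj (R := ℂ) (φ := fun _ : Fin k => ℂ) h σ := by
    ext σ
    simp only [unitFun, smul_eq_mul, ContinuousLinearMap.proj_apply]
    congr 1
    exact Finset.sum_congr rfl fun h _ => by ring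
  rw [this]
  refine HasFDerivAt.const_add _ (HasFDerivAt.fun_sum fun h _ => ?_)
  exact HasFDerivAt.const_smul
    (ContinuousLinearMap.proj (R := ℂ) (φ := fun _ : Fin k => ℂ) h).hasFDerivAt
    ((-1) ^ ((h : ℕ) + 1) * z ^ ((h : ℕ) + 1))

theorem analyticAt_unitFun (z : ℂ) (σ : Fin k → ℂ) : AnalyticAt ℂ (unitFun z) σ := by
  unfold unitFun
  refine analyticAt_const.add (Finset.analyticAt_fun_sum _ fun h _ => ?_)
  exact (analyticAt_const.mul
    ((ContinuousLinearMap.proj (R := ℂ) (φ := fun _ : Fin k => ℂ) h).analyticAt σ)).mul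
      analyticAt_const

theorem unitFun_ne_zero {z : ℂ} {σ : Fin k → ℂ} (h : (unitFun z σ)⁻¹ ∈ Complex.slitPlane) :
    unitFun z σ ≠ 0 :=
  fun h0 => Complex.slitPlane_ne_zero h (by rw [h0, inv_zero])

theorem fderiv_unitFun_inv_cpow {z ν : ℂ} {σ : Fin k → ℂ}
    (h : (unitFun z σ)⁻¹ ∈ Complex.slitPlane) (i : Fin k) :
    fderiv ℂ (fun τ => (unitFun z τ)⁻¹ ^ ν) σ (Pi.single i 1) =
      (-ν * (-1) ^ ((i : ℕ) + 1)) * (z ^ ((i : ℕ) + 1) * (unitFun z σ)⁻¹ ^ (ν + 1)) := by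
  have h0 : (unitFun z σ)⁻¹ ≠ 0 := Complex.slitPlane_ne_zero h
  have hu : unitFun z σ ≠ 0 := unitFun_ne_zero h
  have h1 : HasDerivAt (fun w : ℂ => w⁻¹ ^ ν)
      (ν * (unitFun z σ)⁻¹ ^ (ν - 1) * (-((unitFun z σ) ^ 2)⁻¹)) (unitFun z σ) :=
    (hasDerivAt_inv hu).cpow_const h
  have h2 := (h1.comp_hasFDerivAt σ (hasFDerivAt_unitFun z σ)).fderiv
  have h3 : (fun τ => (unitFun z τ)⁻¹ ^ ν) = (fun w : ℂ => w⁻¹ ^ ν) ∘ unitFun (k := k) z := rfl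
  rw [h3, h2]
  simp only [smul_apply, sum_apply,
    ContinuousLinearMap.proj_apply, smul_eq_mul, Pi.single_apply, mul_ite, mul_one, mul_zero,
    Finset.sum_ite_eq', Finset.mem_univ, if_true]
  rw [Complex.cpow_sub _ _ h0, Complex.cpow_add _ _ h0, Complex.cpow_one]
  field_simp

/-- As |1/a| ≤ 1, all powers of 1/a are bounded by |1/a|, whence |u - 1| ≤ (∑ |x_h|)/|a| < 1. So u
and 1/u have positive real part. This fixes the value of R₀. -/
theorem unitFun_inv_mem_slitPlane {a : ℂ} (ha : 1 + ∑ h : Fin k, ‖x h‖ < ‖a‖) :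
    (unitFun a⁻¹ x)⁻¹ ∈ Complex.slitPlane := by
  have hs : 0 ≤ ∑ h : Fin k, ‖x h‖ := Finset.sum_nonneg fun _ _ => norm_nonneg _
  have ha0 : 0 < ‖a‖ := by linarith
  have hz : ‖a⁻¹‖ ≤ 1 := by
    rw [norm_inv]
    exact inv_le_one_of_one_le₀ (by linarith)
  have h1 : ‖∑ h : Fin k, (-1) ^ ((h : ℕ) + 1) * x h * a⁻¹ ^ ((h : ℕ) + 1)‖ < 1 := by
    calc _ ≤ ∑ h : Fin k, ‖x h‖ * ‖a⁻¹‖ := by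
          refine norm_sum_le_of_le _ fun h _ => ?_
          rw [norm_mul, norm_mul, norm_pow, norm_pow, norm_neg, norm_one, one_pow, one_mul]
          gcongr
          exact pow_le_of_le_one (norm_nonneg _) hz (Nat.succ_ne_zero _)
      _ = (∑ h : Fin k, ‖x h‖) / ‖a‖ := by rw [← Finset.sum_mul, norm_inv, div_eq_mul_inv]
      _ < 1 := by rw [div_lt_one ha0]; linarith
  have h2 : 0 < (unitFun a⁻¹ x).re := by
    rw [unitFun, Complex.add_re, Complex.one_re]
    linarith [(abs_le.1 (Complex.abs_re_le_norm
      (∑ h : Fin k, (-1) ^ ((h : ℕ) + 1) * x h * a⁻¹ ^ ((h : ℕ) + 1)))).1]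
  refine Or.inl ?_
  rw [Complex.inv_re]
  exact div_pos h2 (Complex.normSq_pos.2 fun h0 => by simp [h0] at h2)

theorem analyticAt_powFun {a : ℂ} (ha0 : a ≠ 0) (ha : (unitFun a⁻¹ x)⁻¹ ∈ Complex.slitPlane)
    (ν : ℂ) : AnalyticAt ℂ (powFun ν a) x := by
  have h : powFun ν a = fun σ : Fin k → ℂ => (unitFun a⁻¹ σ)⁻¹ ^ ν := funext (powFun_eq ha0 ν)
  rw [h]
  exact ((analyticAt_unitFun _ x).inv (unitFun_ne_zero ha)).cpow
    analyticAt_const ha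

theorem aeval_unitPoly_germ (z : ℂ) :
    Polynomial.aeval (algebraMap ℂ (HolGerm k x) z) (germFrame k x).unitPoly =
      germAt (unitFun z) (analyticAt_unitFun z x) := by
  have h : germAt (unitFun z) (analyticAt_unitFun z x) = Ideal.Quotient.mk (zeroGerm k x)
      (1 + ∑ h : Fin k, ((-1) ^ ((h : ℕ) + 1) * ⟨fun σ => σ h,
        (ContinuousLinearMap.proj (R := ℂ) (φ := fun _ : Fin k => ℂ) h).analyticAt x⟩) *
          algebraMap ℂ (analyticFun k x) z ^ ((h : ℕ) + 1)) := by
    refine congrArg _ (Subtype.ext (funext fun σ => ?_))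
    simp [unitFun]
  rw [h, Frame.unitPoly]
  simp only [map_add, map_one, map_sum, map_mul, map_pow, map_neg, Polynomial.aeval_C,
    Polynomial.aeval_X]
  rfl

theorem powerFamily_powFun (μ : ℂ) {a : ℂ} (ha0 : a ≠ 0)
    (ha : (unitFun a⁻¹ x)⁻¹ ∈ Complex.slitPlane) :
    (germFrame k x).PowerFamily (B := HolGerm k x) μ (algebraMap ℂ (HolGerm k x) a⁻¹)
      (fun j => germAt (powFun (μ + j) a) (analyticAt_powFun ha0 ha _)) where
  mulHom_smul := germMul_smul
  pd_smul i n j r := by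
    have hd : pd x i • germAt (powFun (μ + j) a) (analyticAt_powFun ha0 ha _) =
        (-(μ + j) * (-1) ^ ((i : ℕ) + 1) * a⁻¹ ^ ((i : ℕ) + 1)) •
          germAt (powFun (μ + (j + 1 : ℕ)) a) (analyticAt_powFun ha0 ha _) := by
      refine mk_eq_of_eventuallyEq
        (g := (-(μ + j) * (-1) ^ ((i : ℕ) + 1) * a⁻¹ ^ ((i : ℕ) + 1)) •
          ⟨powFun (μ + (j + 1 : ℕ)) a, analyticAt_powFun ha0 ha _⟩) ?_
      have hev : ∀ᶠ σ in 𝓝 x, (unitFun a⁻¹ σ)⁻¹ ∈ Complex.slitPlane :=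
        (((analyticAt_unitFun a⁻¹ x).continuousAt).inv₀
          (unitFun_ne_zero ha)).eventually
            (Complex.isOpen_slitPlane.mem_nhds ha)
      filter_upwards [hev] with σ hσ
      simp only [partialFun]
      rw [show powFun (k := k) (μ + j) a = fun σ => (unitFun a⁻¹ σ)⁻¹ ^ (μ + j) from
        funext (powFun_eq ha0 _), fderiv_unitFun_inv_cpow hσ]
      simp only [Subalgebra.coe_smul, Pi.smul_apply, smul_eq_mul, powFun_eq ha0]
      push_cast
      ring_nf
    change pd x i • _ = _
    rw [← map_pow, ← Algebra.smul_def, ← map_pow, ← Algebra.smul_def, smul_smul_germ,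
      smul_smul_germ, hd, smul_smul, smul_smul, smul_smul]
    congr 1
    ring
  step j := by
    rw [aeval_unitPoly_germ]
    refine mk_eq_of_eventuallyEq (f := ⟨unitFun a⁻¹, analyticAt_unitFun _ x⟩ *
      ⟨powFun (μ + (j + 1 : ℕ)) a, analyticAt_powFun ha0 ha _⟩)
      (g := ⟨powFun (μ + j) a, analyticAt_powFun ha0 ha _⟩) ?_
    have hev : ∀ᶠ σ in 𝓝 x, unitFun a⁻¹ σ ≠ 0 :=
      (analyticAt_unitFun a⁻¹ x).continuousAt.eventually_ne
        (unitFun_ne_zero ha)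
    filter_upwards [hev] with σ hσ
    simp only [Subalgebra.coe_mul, Pi.mul_apply, powFun_eq ha0]
    push_cast
    rw [← add_assoc, Complex.cpow_add _ _ (inv_ne_zero hσ), Complex.cpow_one, mul_left_comm,
      mul_inv_cancel₀ hσ, mul_one]

/-- Used to cancel the power of u in G(1/a) u^(-μ-d) = 0. -/
theorem isUnit_germAt_powFun (μ : ℂ) {a : ℂ} (ha0 : a ≠ 0)
    (ha : (unitFun a⁻¹ x)⁻¹ ∈ Complex.slitPlane) :
    IsUnit (germAt (powFun μ a) (analyticAt_powFun ha0 ha μ)) := by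
  have h : germAt (powFun μ a) (analyticAt_powFun ha0 ha μ) *
      germAt (powFun (-μ) a) (analyticAt_powFun ha0 ha _) = 1 := by
    refine mk_eq_of_eventuallyEq (f := ⟨powFun μ a, analyticAt_powFun ha0 ha _⟩ *
        ⟨powFun (-μ) a, analyticAt_powFun ha0 ha _⟩) (g := 1) ?_
    have hev : ∀ᶠ σ in 𝓝 x, unitFun a⁻¹ σ ≠ 0 :=
      (analyticAt_unitFun a⁻¹ x).continuousAt.eventually_ne (unitFun_ne_zero ha)
    filter_upwards [hev] with σ hσ
    simp only [Subalgebra.coe_mul, Pi.mul_apply, powFun_eq ha0, Subalgebra.coe_one, Pi.one_apply]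
    rw [← Complex.cpow_add _ _ (inv_ne_zero hσ), add_neg_cancel, Complex.cpow_zero]
  exact isUnit_of_mul_eq_one_comm (A := HolGerm k x) h

theorem mem_idealI_iff_kills_powFun {μ : ℂ} (hμ : ∀ n : ℕ, μ ≠ -(n : ℂ)) {R : ℝ}
    (hR : 1 + ∑ h : Fin k, ‖x h‖ ≤ R) (Q : DiffOp k x) :
    Q ∈ idealI μ x ↔ ∀ a : ℂ, R < ‖a‖ → Kills Q (powFun μ a) := by
  have hs : 0 ≤ ∑ h : Fin k, ‖x h‖ := Finset.sum_nonneg fun _ _ => norm_nonneg _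
  have hne : ∀ a : ℂ, R < ‖a‖ → a ≠ 0 := fun a ha => norm_pos_iff.1 (by linarith)
  have hsl : ∀ a : ℂ, R < ‖a‖ → (unitFun a⁻¹ x)⁻¹ ∈ Complex.slitPlane := fun a ha =>
    unitFun_inv_mem_slitPlane (hR.trans_lt ha)
  have h0 : ∀ a (ha : R < ‖a‖), Kills Q (powFun μ a) ↔
      Q • germAt (powFun (μ + (0 : ℕ)) a) (analyticAt_powFun (hne a ha) (hsl a ha) _) = 0 := by
    intro a ha
    rw [kills_iff Q (analyticAt_powFun (hne a ha) (hsl a ha) _)]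
    simp only [Nat.cast_zero, add_zero]
  rw [← idealI_germFrame]
  constructor
  · intro hQ a ha
    rw [h0 a ha]
    exact (powerFamily_powFun μ (hne a ha) (hsl a ha)).smul_eq_zero hQ
  · intro h
    obtain ⟨d, G, hG, hact⟩ := (germFrame k x).exists_symbol hμ Q
    refine hG (polynomial_eq_zero_of_infinite (S := (fun a : ℂ => a⁻¹) '' {a | R < ‖a‖}) ?_ ?_)
    · refine Set.Infinite.image inv_injective.injOn ?_
      -- Explicit real values of a beyond R show that infinitely many scalars 1/a are available.
      refine Set.infinite_of_injective_forall_mem (f := fun n : ℕ => ((|R| + 1 + n : ℝ) : ℂ))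
        (fun m n h => by simpa using h) fun n => ?_
      have h1 : (0 : ℝ) ≤ |R| + 1 + n := by positivity
      rw [Set.mem_ofPred_eq, Complex.norm_of_nonneg h1]
      linarith [le_abs_self R, (Nat.cast_nonneg n : (0 : ℝ) ≤ n)]
    · rintro _ ⟨a, ha, rfl⟩
      have h1 := hact (powerFamily_powFun μ (hne a ha) (hsl a ha))
      rw [(h0 a ha).1 (h a ha)] at h1
      exact (isUnit_germAt_powFun (μ + d) (hne a ha) (hsl a ha)).mul_left_eq_zero.1 h1.symm

end PowFun

/-! ### The formal binomial series -/

theorem choose_succ_mul (r : ℂ) (p : ℕ) :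
    Ring.choose r (p + 1) * (p + 1) = r * Ring.choose (r - 1) p := by
  have h := Ring.choose_smul_choose r (n := p + 1) (k := 1) (by omega)
  simp only [Nat.choose_one_right, nsmul_eq_mul, Ring.choose_one_right, Nat.cast_one,
    Nat.add_sub_cancel] at h
  rw [← h]
  push_cast
  ring

theorem powerSeries_ext_of_X_pow_dvd {A : Type*} [CommRing A] {f g : PowerSeries A}
    (h : ∀ N : ℕ, PowerSeries.X ^ N ∣ f - g) : f = g := by
  ext n
  have := PowerSeries.X_pow_dvd_iff.1 (h (n + 1)) n (Nat.lt_succ_self n)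
  rwa [map_sub, sub_eq_zero] at this

theorem aeval_X_series {A : Type*} [CommRing A] (G : Polynomial A) :
    Polynomial.aeval (PowerSeries.X : PowerSeries A) G = (G : PowerSeries A) := by
  induction G using Polynomial.induction_on' with
  | add p q hp hq => rw [map_add, hp, hq, Polynomial.coe_add]
  | monomial n a =>
    ext m
    simp [PowerSeries.coeff_X_pow, PowerSeries.coeff_monomial]

namespace Frame

variable {k : ℕ} {A D : Type*} [CommRing A] [Algebra ℂ A] [Ring D] [Algebra ℂ D] (W : Frame k A D)

/-- The action of `D` on `A` by differential operators. -/
structure Acts [Module D A] : Prop where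
  mulHom_smul : ∀ c g : A, W.mulHom c • g = c * g
  pd_smul_mul : ∀ (i : Fin k) (f g : A), W.pd i • (f * g) = f * W.pd i • g + (W.pd i • f) * g
  pd_smul_cg : ∀ i j : Fin k, W.pd i • W.cg j = if i = j then 1 else 0
  smul_smul_comm : ∀ (Q : D) (r : ℂ) (g : A), Q • (r • g) = r • (Q • g)

/-- The series `∑ (-1)^h σ_h X^h`. -/
def coordSeries : PowerSeries A :=
  ∑ h : Fin k, PowerSeries.C ((-1) ^ ((h : ℕ) + 1) * W.cg h) * PowerSeries.X ^ ((h : ℕ) + 1)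

/-- The partial sums of the binomial series of `(1 + ∑ (-1)^h σ_h X^h) ^ (-ν)`. -/
def binomSum (ν : ℂ) (N : ℕ) : PowerSeries A :=
  ∑ p ∈ Finset.range N, Ring.choose (-ν) p • W.coordSeries ^ p

/-- The formal power `(1 + ∑ (-1)^h σ_h X^h) ^ (-ν)`. -/
def binomPow (ν : ℂ) : PowerSeries A :=
  PowerSeries.mk fun q => PowerSeries.coeff q (W.binomSum ν (q + 1))

theorem X_pow_dvd_coordSeries_pow (p : ℕ) : PowerSeries.X ^ p ∣ W.coordSeries ^ p := by
  refine pow_dvd_pow_of_dvd (Finset.dvd_sum fun h _ => ?_) p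
  exact Dvd.dvd.mul_left (dvd_pow_self _ (Nat.succ_ne_zero _)) _

theorem X_pow_dvd_binomPow_sub (ν : ℂ) (N : ℕ) :
    PowerSeries.X ^ N ∣ W.binomPow ν - W.binomSum ν N := by
  refine PowerSeries.X_pow_dvd_iff.2 fun m hm => ?_
  rw [map_sub, binomPow, PowerSeries.coeff_mk, sub_eq_zero, binomSum, binomSum, map_sum, map_sum]
  refine Finset.sum_subset (Finset.range_subset_range.2 hm) fun p _ hp => ?_
  have h0 := PowerSeries.X_pow_dvd_iff.1 (W.X_pow_dvd_coordSeries_pow p) m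
    (by simpa using hp)
  rw [PowerSeries.coeff_smul, h0, smul_zero]

/-- This is Pascal's rule at finite level. The correction term is divisible by X^N and disappears in
the limit, which gives (1 + s) (1 + s)^(-ν-1) = (1 + s)^(-ν). -/
theorem one_add_mul_binomSum (ν : ℂ) (N : ℕ) :
    (1 + W.coordSeries) * W.binomSum (ν + 1) N + Ring.choose (-ν - 1) N • W.coordSeries ^ N =
      W.binomSum ν (N + 1) := by
  induction N with
  | zero => simp [binomSum]
  | succ N ih =>
    have h : Ring.choose (-ν) (N + 1) = Ring.choose (-ν - 1) N + Ring.choose (-ν - 1) (N + 1) := by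
      have := Ring.choose_succ_succ (-ν - 1) N
      rwa [sub_add_cancel] at this
    have h' : -(ν + 1) = -ν - 1 := by ring
    have h1 : W.binomSum ν (N + 1 + 1) = _ := Finset.sum_range_succ _ _
    have h2 : W.binomSum (ν + 1) (N + 1) = _ := Finset.sum_range_succ _ _
    rw [h1, h2, ← binomSum, ← binomSum, ← ih, h', h]
    simp only [Algebra.smul_def, map_add]
    ring

theorem one_add_mul_binomPow (ν : ℂ) :
    (1 + W.coordSeries) * W.binomPow (ν + 1) = W.binomPow ν := by
  refine powerSeries_ext_of_X_pow_dvd fun N => ?_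
  have h1 := (W.X_pow_dvd_binomPow_sub (ν + 1) N).mul_left (1 + W.coordSeries)
  have h2 := (pow_dvd_pow PowerSeries.X N.le_succ).trans (W.X_pow_dvd_binomPow_sub ν (N + 1))
  have h3 := (W.X_pow_dvd_coordSeries_pow N).mul_left
    (algebraMap ℂ (PowerSeries A) (Ring.choose (-ν - 1) N))
  rw [← one_add_mul_binomSum, Algebra.smul_def] at h2
  have := dvd_sub (dvd_sub h1 h2) h3
  ring_nf at this ⊢
  exact this

theorem constantCoeff_binomPow (ν : ℂ) : PowerSeries.constantCoeff (W.binomPow ν) = 1 := by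
  rw [← PowerSeries.coeff_zero_eq_constantCoeff_apply, binomPow, PowerSeries.coeff_mk]
  simp [binomSum]

theorem aeval_X_unitPoly :
    Polynomial.aeval (PowerSeries.X : PowerSeries A) W.unitPoly = 1 + W.coordSeries := by
  simp only [unitPoly, coordSeries, map_add, map_one, map_sum, map_mul, Polynomial.aeval_C, map_pow,
    Polynomial.aeval_X, PowerSeries.algebraMap_apply, Algebra.algebraMap_self, RingHom.id_apply]

/-! ### The polynomials `Φ_{μ,q}` -/

/-- By the multinomial theorem, the monomial with exponents α carries both X and the sign -1 to the
power ∑ h α_h, so extracting degree q selects weight q and the common sign (-1)^q. -/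
theorem coeff_coordSeries_pow (p q : ℕ) : PowerSeries.coeff q (W.coordSeries ^ p) =
    (-1) ^ q * MvPolynomial.aeval W.cg (mTilde k p q) := by
  have hterm : ∀ α : Fin k → ℕ, (∏ h : Fin k, (PowerSeries.C ((-1) ^ ((h : ℕ) + 1) * W.cg h) *
      PowerSeries.X ^ ((h : ℕ) + 1) : PowerSeries A) ^ α h) =
      PowerSeries.C ((-1) ^ (∑ h : Fin k, ((h : ℕ) + 1) * α h) * ∏ h : Fin k, W.cg h ^ α h) *
        PowerSeries.X ^ (∑ h : Fin k, ((h : ℕ) + 1) * α h) := by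
    intro α
    simp only [mul_pow, Finset.prod_mul_distrib, ← pow_mul, Finset.prod_pow_eq_pow_sum, map_mul,
      map_pow, map_prod, map_neg, map_one]
  rw [coordSeries, Finset.sum_pow_eq_sum_piAntidiag, map_sum, mTilde, map_sum, Finset.mul_sum,
    Finset.sum_filter]
  symm
  refine Finset.sum_bij' (fun α _ => ⇑α) (fun α _ => Finsupp.equivFunOnFinite.symm α)
    ?_ ?_ ?_ ?_ ?_
  · intro α hα
    simpa using (Finset.mem_finsuppAntidiag.1 hα).1
  · intro α hα
    simpa using hα
  · intro α _
    ext
    simp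
  · intro α _
    rfl
  · intro α hα
    have hα' : ∑ h : Fin k, α h = p := (Finset.mem_finsuppAntidiag.1 hα).1
    rw [hterm, ← map_natCast (PowerSeries.C (R := A)), ← mul_assoc, ← map_mul,
      PowerSeries.coeff_C_mul, PowerSeries.coeff_X_pow]
    by_cases hq : ∑ h : Fin k, ((h : ℕ) + 1) * α h = q
    · have hm : ((p.factorial : ℂ) / ∏ h : Fin k, ((α h).factorial : ℂ)) =
          (Nat.multinomial Finset.univ α : ℂ) := by
        rw [div_eq_iff (Finset.prod_ne_zero_iff.2 fun h _ =>
          Nat.cast_ne_zero.2 (Nat.factorial_ne_zero _)), ← hα', ← Nat.multinomial_spec]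
        push_cast
        ring
      rw [if_pos hq, if_pos hq.symm, MvPolynomial.aeval_monomial, hm, hq, map_natCast,
        Finsupp.prod_fintype _ _ (by simp)]
      ring
    · rw [if_neg hq, if_neg (Ne.symm hq), mul_zero]

theorem coeff_binomPow (ν : ℂ) (q : ℕ) :
    PowerSeries.coeff q (W.binomPow ν) = MvPolynomial.aeval W.cg (Phi k ν q) := by
  rw [binomPow, PowerSeries.coeff_mk, binomSum, Phi, map_mul, map_sum, map_sum, Finset.mul_sum]
  refine Finset.sum_congr rfl fun p _ => ?_
  rw [PowerSeries.coeff_smul, coeff_coordSeries_pow, map_smul, mul_smul_comm]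
  simp

/-! ### Differential operators acting on series -/

variable {W} [Module D A]

/-- Operators act on series coefficientwise, so annihilating a series means annihilating each
coefficient. -/
theorem coeff_op_smul {A D : Type*} [CommRing A] [Ring D] [Module D A] (Q : D) (f : PowerSeries A) (n : ℕ) :
    PowerSeries.coeff n (Q • f) = Q • PowerSeries.coeff n f := rfl

theorem X_pow_dvd_smul {A D : Type*} [CommRing A] [Ring D] [Module D A] (Q : D) {f : PowerSeries A} {N : ℕ} (h : PowerSeries.X ^ N ∣ f) :
    PowerSeries.X ^ N ∣ Q • f := by
  refine PowerSeries.X_pow_dvd_iff.2 fun m hm => ?_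
  rw [coeff_op_smul, PowerSeries.X_pow_dvd_iff.1 h m hm, smul_zero]

namespace Acts

theorem smul_smul_series (hW : W.Acts) (Q : D) (r : ℂ) (f : PowerSeries A) : Q • (r • f) = r • (Q • f) := by
  ext n
  simp only [coeff_op_smul, hW.smul_smul_comm]

theorem pd_smul_mul_series (hW : W.Acts) (i : Fin k) (f g : PowerSeries A) :
    W.pd i • (f * g) = f * W.pd i • g + (W.pd i • f) * g := by
  ext n
  simp only [coeff_op_smul, PowerSeries.coeff_mul, map_add, Finset.smul_sum, hW.pd_smul_mul,
    Finset.sum_add_distrib]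

theorem pd_smul_C_mul_X_pow (i : Fin k) (c : A) (n : ℕ) :
    W.pd i • (PowerSeries.C c * PowerSeries.X ^ n : PowerSeries A) =
      PowerSeries.C (W.pd i • c) * PowerSeries.X ^ n := by
  ext m
  simp only [coeff_op_smul, PowerSeries.coeff_C_mul, PowerSeries.coeff_X_pow]
  split_ifs <;> simp

theorem pd_smul_one (hW : W.Acts) (i : Fin k) : W.pd i • (1 : A) = 0 := by
  simpa using hW.pd_smul_mul i 1 1

theorem pd_smul_coordSeries (hW : W.Acts) (i : Fin k) :
    W.pd i • W.coordSeries = ((-1 : ℂ) ^ ((i : ℕ) + 1)) • PowerSeries.X ^ ((i : ℕ) + 1) := by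
  have h1 : ∀ h : Fin k, W.pd i • ((-1) ^ ((h : ℕ) + 1) * W.cg h) =
      if i = h then (-1) ^ ((h : ℕ) + 1) else 0 := by
    intro h
    have := hW.pd_smul_cg i h
    rcases neg_one_pow_eq_or A ((h : ℕ) + 1) with h0 | h0
    · rw [h0, one_mul, this]
    · rw [h0, neg_one_mul, smul_neg, this]
      split_ifs <;> simp
  simp only [coordSeries, Finset.smul_sum, pd_smul_C_mul_X_pow, h1]
  rw [Finset.sum_eq_single_of_mem i (Finset.mem_univ i)]
  · simp [Algebra.smul_def]
  · intro b _ hb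
    simp [hb.symm]

theorem pd_smul_coordSeries_pow (hW : W.Acts) (i : Fin k) (p : ℕ) :
    W.pd i • W.coordSeries ^ (p + 1) =
      ((p + 1 : ℂ) * (-1) ^ ((i : ℕ) + 1)) •
        (PowerSeries.X ^ ((i : ℕ) + 1) * W.coordSeries ^ p) := by
  induction p with
  | zero => simp [hW.pd_smul_coordSeries]
  | succ p ih =>
    rw [pow_succ, hW.pd_smul_mul_series, ih, hW.pd_smul_coordSeries]
    simp only [Algebra.smul_def, map_mul, map_add, Nat.cast_add, Nat.cast_one, map_one]
    ring

/-- The term p = 0 is constant and dies, so N + 1 terms become N. The others match by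
`choose_succ_mul`. -/
theorem pd_smul_binomSum (hW : W.Acts) (i : Fin k) (ν : ℂ) (N : ℕ) :
    W.pd i • W.binomSum ν (N + 1) = (-ν * (-1) ^ ((i : ℕ) + 1)) •
      (PowerSeries.X ^ ((i : ℕ) + 1) * W.binomSum (ν + 1) N) := by
  have h0 : W.pd i • (1 : PowerSeries A) = 0 := by
    have := pd_smul_C_mul_X_pow (W := W) i (1 : A) 0
    simpa [hW.pd_smul_one] using this
  rw [binomSum, Finset.sum_range_succ', smul_add, hW.smul_smul_series, pow_zero, h0, smul_zero,
    add_zero, Finset.smul_sum, binomSum, Finset.mul_sum, Finset.smul_sum]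
  refine Finset.sum_congr rfl fun p _ => ?_
  have h := choose_succ_mul (-ν) p
  rw [hW.smul_smul_series, hW.pd_smul_coordSeries_pow, mul_smul_comm, smul_smul, smul_smul,
    ← mul_assoc, h, neg_add']
  congr 1
  ring

theorem pd_smul_binomPow (hW : W.Acts) (i : Fin k) (ν : ℂ) :
    W.pd i • W.binomPow ν = (-ν * (-1) ^ ((i : ℕ) + 1)) •
      (PowerSeries.X ^ ((i : ℕ) + 1) * W.binomPow (ν + 1)) := by
  refine powerSeries_ext_of_X_pow_dvd fun N => ?_
  have h1 := (pow_dvd_pow PowerSeries.X N.le_succ).trans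
    (X_pow_dvd_smul (W.pd i) (W.X_pow_dvd_binomPow_sub ν (N + 1)))
  have h2 := (W.X_pow_dvd_binomPow_sub (ν + 1) N).mul_left
    (algebraMap ℂ (PowerSeries A) (-ν * (-1) ^ ((i : ℕ) + 1)) * PowerSeries.X ^ ((i : ℕ) + 1))
  rw [smul_sub, hW.pd_smul_binomSum] at h1
  have := dvd_sub h1 h2
  rw [Algebra.smul_def] at this ⊢
  ring_nf at this ⊢
  exact this

theorem powerFamily_binomPow (hW : W.Acts) (μ : ℂ) :
    W.PowerFamily (B := PowerSeries A) μ PowerSeries.X (fun j => W.binomPow (μ + j)) where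
  mulHom_smul c b := by
    ext n
    rw [coeff_op_smul, hW.mulHom_smul, PowerSeries.algebraMap_apply, PowerSeries.coeff_C_mul]
    rfl
  pd_smul i n j r := by
    have h0 : W.pd i • (PowerSeries.X ^ n : PowerSeries A) = 0 := by
      have := pd_smul_C_mul_X_pow (W := W) i (1 : A) n
      simpa [hW.pd_smul_one] using this
    rw [hW.smul_smul_series, hW.pd_smul_mul_series, h0, zero_mul, add_zero, hW.pd_smul_binomPow,
      mul_smul_comm, smul_smul, ← mul_assoc (PowerSeries.X ^ n), ← pow_add]
    push_cast
    rw [add_assoc μ]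
  step j := by
    rw [aeval_X_unitPoly, ← W.one_add_mul_binomPow (μ + j)]
    push_cast
    rw [add_assoc]

theorem mem_idealI_iff_coeff (hW : W.Acts) {μ : ℂ} (hμ : ∀ n : ℕ, μ ≠ -(n : ℂ)) (Q : D) :
    Q ∈ W.idealI μ ↔ ∀ q, Q • PowerSeries.coeff q (W.binomPow μ) = 0 := by
  have hF := hW.powerFamily_binomPow μ
  have h0 : W.binomPow (μ + (0 : ℕ)) = W.binomPow μ := by simp
  constructor
  · intro hQ q
    rw [← coeff_op_smul, ← h0, hF.smul_eq_zero hQ, map_zero]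
  · intro h
    obtain ⟨d, G, hG, hact⟩ := W.exists_symbol hμ Q
    have h1 := hact hF
    have h2 : Q • W.binomPow (μ + (0 : ℕ)) = 0 := by
      ext q
      rw [h0, coeff_op_smul, h q, map_zero]
    -- A series with constant term 1 is invertible, so the vanishing of G(X) u^(-μ-d) forces G = 0.
    have hu : IsUnit (W.binomPow (μ + d)) := by
      rw [PowerSeries.isUnit_iff_constantCoeff, constantCoeff_binomPow]
      exact isUnit_one
    rw [h2] at h1
    have h3 := hu.mul_left_eq_zero.1 h1.symm
    refine hG (Polynomial.coe_injective A ?_)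
    rw [Polynomial.coe_zero, ← h3, aeval_X_series]

end Acts

end Frame

/-! ### Polynomials as germs -/

section PolyGerm

variable {k : ℕ} {x : Fin k → ℂ}

theorem acts_germFrame : (germFrame k x).Acts where
  mulHom_smul := germMul_smul
  pd_smul_mul := pd_smul_mul
  pd_smul_cg := pd_smul_coordGerm
  smul_smul_comm := smul_smul_germ

/-- A coordinate as a function analytic at `x`. -/
def coordFun (x : Fin k → ℂ) (i : Fin k) : analyticFun k x :=
  ⟨fun σ => σ i, (ContinuousLinearMap.proj (R := ℂ) (φ := fun _ : Fin k => ℂ) i).analyticAt x⟩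

/-- A polynomial as a function analytic at `x`. -/
def polyFun (x : Fin k → ℂ) : MvPolynomial (Fin k) ℂ →ₐ[ℂ] analyticFun k x :=
  MvPolynomial.aeval (coordFun x)

theorem polyFun_X (i : Fin k) : polyFun x (MvPolynomial.X i) = coordFun x i :=
  MvPolynomial.aeval_X _ i

theorem polyFun_apply (P : MvPolynomial (Fin k) ℂ) (σ : Fin k → ℂ) :
    (polyFun x P : (Fin k → ℂ) → ℂ) σ = MvPolynomial.eval σ P := by
  induction P using MvPolynomial.induction_on with
  | C a =>
    rw [MvPolynomial.eval_C, ← MvPolynomial.algebraMap_eq, AlgHom.commutes]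
    rfl
  | add p q hp hq => simp [hp, hq]
  | mul_X p i hp =>
    rw [map_mul, map_mul, polyFun_X, MvPolynomial.eval_X, ← hp]
    rfl

theorem analyticAt_eval (P : MvPolynomial (Fin k) ℂ) :
    AnalyticAt ℂ (fun σ => MvPolynomial.eval σ P) x := by
  have h : (fun σ => MvPolynomial.eval σ P) = (polyFun x P : (Fin k → ℂ) → ℂ) :=
    funext fun σ => (polyFun_apply P σ).symm
  rw [h]
  exact (polyFun x P).2

theorem germAt_eval (P : MvPolynomial (Fin k) ℂ) :
    germAt (fun σ => MvPolynomial.eval σ P) (analyticAt_eval (x := x) P) =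
      MvPolynomial.aeval (germFrame k x).cg P := by
  have h1 : germAt (fun σ => MvPolynomial.eval σ P) (analyticAt_eval (x := x) P) =
      Ideal.Quotient.mkₐ ℂ (zeroGerm k x) (polyFun x P) :=
    congrArg _ (Subtype.ext (funext fun σ => (polyFun_apply P σ).symm))
  have h2 : (Ideal.Quotient.mkₐ ℂ (zeroGerm k x)).comp (polyFun x) =
      MvPolynomial.aeval (germFrame k x).cg := by
    refine MvPolynomial.algHom_ext fun i => ?_
    rw [AlgHom.comp_apply, polyFun_X, MvPolynomial.aeval_X]
    rfl
  exact h1.trans (DFunLike.congr_fun h2 P)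

theorem mem_idealI_iff_kills_Phi {μ : ℂ} (hμ : ∀ n : ℕ, μ ≠ -(n : ℂ)) (Q : DiffOp k x) :
    Q ∈ idealI μ x ↔ ∀ q : ℕ, Kills Q (fun σ => MvPolynomial.eval σ (Phi k μ q)) := by
  refine (Frame.Acts.mem_idealI_iff_coeff (acts_germFrame (k := k) (x := x)) hμ Q).trans
    (forall_congr' fun q => ?_)
  rw [kills_iff Q (analyticAt_eval _), germAt_eval, Frame.coeff_binomPow]

end PolyGerm

end TraceSystem

end

theorem proposition2p2p2 (k : ℕ) (μ : ℂ) (hμ : ∀ n : ℕ, μ ≠ -(n : ℂ)) (x : Fin k → ℂ) :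
    (∃ R₀ : ℝ, ∀ R : ℝ, R₀ ≤ R → ∀ Q : TraceSystem.DiffOp k x,
      Q ∈ TraceSystem.idealI μ x ↔
        ∀ a : ℂ, R < ‖a‖ → TraceSystem.Kills Q (TraceSystem.powFun μ a)) ∧
    (∀ Q : TraceSystem.DiffOp k x,
      Q ∈ TraceSystem.idealI μ x ↔
        ∀ q : ℕ, TraceSystem.Kills Q (fun σ => MvPolynomial.eval σ (TraceSystem.Phi k μ q))) :=
  ⟨⟨1 + ∑ h : Fin k, ‖x h‖, fun _ hR Q => TraceSystem.mem_idealI_iff_kills_powFun hμ hR Q⟩,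
    fun Q => TraceSystem.mem_idealI_iff_kills_Phi hμ Q⟩
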